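/- Let $X$ be a reflexive real Banach space with topological dual $X^*$, let $C\subseteq X$ be nonempty, closed and convex, and let $F:C\times C\to\mathbb{R}$ satisfy $F(x,x)=0$ for all $x\in C$. Suppose that $F$ is BO-maximal monotone (Blum--Oettli maximal monotone), that is, $F$ is monotone, meaning $F(x,y)+F(y,x)\le 0$ for all $x,y\in C$, and for every $(x,x^*)\in C\times X^*$ the following implication holds: $$F(y,x)+\langle x^*,y-x\rangle\le 0\ \ \forall y\in C\quad\Longrightarrow\quad F(x,y)\ge\langle x^*,y-x\rangle\ \ \forall y\in C.$$ If $F(x,\cdot)$ is convex and lower semicontinuous on $C$ for all $x\in C$, then $F$ is maximal monotone; that is, $F$ is monotone and the operator $A^F:X\rightrightarrows X^*$ given by $$A^F(x)=\{x^*\in X^*: F(x,y)-F(x,x)\ge\langle x^*,y-x\rangle\ \ \forall y\in C\}\ \text{ if } x\in C,\qquad A^F(x)=\emptyset\ \text{ if } x\notin C,$$ is a maximal monotone operator: $\langle y^*-x^*,y-x\rangle\ge 0$ whenever $x^*\in A^F(x)$ and $y^*\in A^F(y)$, and the graph of $A^F$ is not properly included in the graph of any other operator $X\rightrightarrows X^*$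 with this monotonicity property. -/

import Mathlib

/-!
The Fitzpatrick transform `φ(u, u') = sup_{y ∈ C} (u' y + F y u)` is a convex function on `X × X*`
that majorizes the pairing and, by monotonicity of `F`, is majorized by the conjugate `(F u)*(u')`.
Given `(x₀, x₀')`, translate it to the origin and separate the epigraph of `φ` from the hypograph of
`-½‖·‖² - ½‖·‖²`. By reflexivity this gives a pair `(x, x')` such that the Fenchel–Young gap
`D = ½‖x - x₀‖² + ½‖x' - x₀'‖² + (x' - x₀') (x - x₀) ≥ 0` satisfies
`D ≤ φ(u, u') - x' u - u' x + x' x`. Using `φ(u, ·) ≤ (F u)*` and taking the supremum over `u'`, the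
Fenchel–Moreau theorem turns this into `x ∈ C` and `F u x ≤ x' (x - u) - D` for all `u ∈ C`.
BO-maximality then puts `x'` in `A^F x`, and `u = x` gives `D ≤ 0`. If `(x₀, x₀')` is monotonically
related to the graph of `A^F`, this forces `(x, x') = (x₀, x₀')`.
-/

/-- A real normed space is reflexive: the canonical embedding into its bidual is onto. -/
def IsReflexiveSpace (X : Type*) [NormedAddCommGroup X] [NormedSpace ℝ X] : Prop :=
  Function.Surjective (NormedSpace.inclusionInDoubleDual ℝ X)

/-- The graph of a multifunction `T : X ⇉ X*`. -/
def operatorGraph {X : Type*} [NormedAddCommGroup X] [NormedSpace ℝ X]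
    (T : X → Set (StrongDual ℝ X)) : Set (X × StrongDual ℝ X) :=
  {p | p.2 ∈ T p.1}

/-- `T : X ⇉ X*` is a monotone operator. -/
def IsMonotoneOperator {X : Type*} [NormedAddCommGroup X] [NormedSpace ℝ X]
    (T : X → Set (StrongDual ℝ X)) : Prop :=
  ∀ x y : X, ∀ x' ∈ T x, ∀ y' ∈ T y, 0 ≤ (y' - x') (y - x)

/-- `T` is maximal monotone: it is monotone and its graph is not properly included in the
graph of any monotone operator. -/
def IsMaximalMonotoneOperator {X : Type*} [NormedAddCommGroup X] [NormedSpace ℝ X]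
    (T : X → Set (StrongDual ℝ X)) : Prop :=
  IsMonotoneOperator T ∧
    ∀ S : X → Set (StrongDual ℝ X), IsMonotoneOperator S → ¬ operatorGraph T ⊂ operatorGraph S

/-- `F : C × C → ℝ` is a monotone bifunction. A bifunction on `C` is represented by a total
function `F : X → X → ℝ`, of which only the values on `C × C` are ever used. -/
def IsMonotoneBifunction {X : Type*} (C : Set X) (F : X → X → ℝ) : Prop :=
  ∀ x ∈ C, ∀ y ∈ C, F x y + F y x ≤ 0

/-- The operator `A^F : X ⇉ X*` of a bifunction `F` on `C`; it is empty-valued off `C`. -/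
def bifunctionOperator {X : Type*} [NormedAddCommGroup X] [NormedSpace ℝ X]
    (C : Set X) (F : X → X → ℝ) (x : X) : Set (StrongDual ℝ X) :=
  {x' | x ∈ C ∧ ∀ y ∈ C, x' (y - x) ≤ F x y - F x x}

/-- A maximal monotone bifunction: `F` is monotone and `A^F` is a maximal monotone operator. -/
def IsMaximalMonotoneBifunction {X : Type*} [NormedAddCommGroup X] [NormedSpace ℝ X]
    (C : Set X) (F : X → X → ℝ) : Prop :=
  IsMonotoneBifunction C F ∧ IsMaximalMonotoneOperator (bifunctionOperator C F)

/-- A BO-maximal monotone (Blum-Oettli maximal monotone) bifunction. -/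
def IsBOMaximalMonotoneBifunction {X : Type*} [NormedAddCommGroup X] [NormedSpace ℝ X]
    (C : Set X) (F : X → X → ℝ) : Prop :=
  IsMonotoneBifunction C F ∧
    ∀ x ∈ C, ∀ x' : StrongDual ℝ X,
      (∀ y ∈ C, F y x + x' (y - x) ≤ 0) → ∀ y ∈ C, x' (y - x) ≤ F x y

section FenchelConjugate

variable {E : Type*} [AddCommGroup E] [Module ℝ E] [TopologicalSpace E]

/-- The epigraph of the Fenchel conjugate of `φ`, where `φ` is regarded as `+∞` off `C`. Its points
`(l, r)` are the continuous affine minorants `l - r` of `φ` on `C`. -/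
def conjugateEpigraph (C : Set E) (φ : E → ℝ) : Set (StrongDual ℝ E × ℝ) :=
  {p | ∀ y ∈ C, p.1 y - p.2 ≤ φ y}

variable [IsTopologicalAddGroup E] [ContinuousSMul ℝ E]

theorem exists_dual_sub_le_sub_of_concaveOn {S : Set (E × ℝ)} (hS : Convex ℝ S)
    (hSne : S.Nonempty) {g : E → ℝ} (hg : ConcaveOn ℝ Set.univ g) (hgc : Continuous g)
    (hle : ∀ p ∈ S, g p.1 ≤ p.2) :
    ∃ L : StrongDual ℝ E, ∀ p ∈ S, ∀ q, g q - L q ≤ p.2 - L p.1 := by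
  have hopen : IsOpen {p : E × ℝ | p.1 ∈ Set.univ ∧ p.2 < g p.1} := by
    simpa only [Set.mem_univ, true_and] using isOpen_lt continuous_snd hgc.fst'
  have hdisj : Disjoint {p : E × ℝ | p.1 ∈ Set.univ ∧ p.2 < g p.1} S :=
    Set.disjoint_left.2 fun p hp hpS ↦ (hle p hpS).not_gt hp.2
  obtain ⟨f, s, hf_lt, hf_ge⟩ :=
    geometric_hahn_banach_open hg.convex_strict_hypograph hopen hS hdisj
  have hsplit (q : E) (t : ℝ) : f (q, t) = f (q, 0) + t * f (0, 1) := by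
    rw [← smul_eq_mul, ← map_smul, ← map_add]
    simp
  have hsep {p} (hp : p ∈ S) {q : E} {t : ℝ} (ht : t < g q) :
      f (q, 0) + t * f (0, 1) < f (p.1, 0) + p.2 * f (0, 1) := by
    rw [← hsplit, ← hsplit]
    exact (hf_lt (q, t) ⟨trivial, ht⟩).trans_le (hf_ge p hp)
  have hpos : 0 < f (0, 1) := by
    obtain ⟨p, hp⟩ := hSne
    have hmul : 0 < (p.2 - (g p.1 - 1)) * f (0, 1) := by
      linarith [hsep hp (sub_one_lt (g p.1))]
    exact (mul_pos_iff_of_pos_left (by linarith [hle p hp])).1 hmul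
  refine ⟨-(f (0, 1))⁻¹ • f.comp (ContinuousLinearMap.inl ℝ E ℝ), fun p hp q ↦ ?_⟩
  refine sub_le_iff_le_add.2 (le_of_forall_lt fun t ht ↦ ?_)
  have hscaled := (mul_lt_mul_iff_right₀ (inv_pos.2 hpos)).2 (hsep hp ht)
  have hcancel : (f (0, 1))⁻¹ * f (0, 1) = 1 := inv_mul_cancel₀ hpos.ne'
  simp only [smul_apply, ContinuousLinearMap.comp_apply, ContinuousLinearMap.inl_apply, smul_eq_mul]
  linear_combination hscaled + (p.2 - t) * hcancel

variable [LocallyConvexSpace ℝ E] {C : Set E} {φ : E → ℝ} {x : E} {M : ℝ}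

theorem exists_mem_conjugateEpigraph_apply_sub_eq (hC : IsClosed C) (hφ : ConvexOn ℝ C φ)
    (hφc : LowerSemicontinuousOn φ C) (hx : x ∈ C) {a : ℝ} (ha : a < φ x) :
    ∃ p ∈ conjugateEpigraph C φ, p.1 x - p.2 = a := by
  obtain ⟨l, c, hle, heq⟩ := hφ.exists_affine_le_of_lt (𝕜 := ℝ) hx ha hC hφc
  exact ⟨(l, -c), fun y hy ↦ by simpa using hle ⟨y, hy⟩, by simpa using heq⟩

theorem conjugateEpigraph_nonempty (hC : IsClosed C) (hφ : ConvexOn ℝ C φ)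
    (hφc : LowerSemicontinuousOn φ C) : (conjugateEpigraph C φ).Nonempty := by
  obtain rfl | ⟨x, hx⟩ := C.eq_empty_or_nonempty
  · exact ⟨0, by simp [conjugateEpigraph]⟩
  · obtain ⟨p, hp, -⟩ :=
      exists_mem_conjugateEpigraph_apply_sub_eq hC hφ hφc hx (sub_one_lt (φ x))
    exact ⟨p, hp⟩

theorem mem_of_forall_mem_conjugateEpigraph (hCconv : Convex ℝ C) (hC : IsClosed C)
    (hne : (conjugateEpigraph C φ).Nonempty)
    (h : ∀ p ∈ conjugateEpigraph C φ, p.1 x - p.2 ≤ M) : x ∈ C := by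
  by_contra hx
  obtain ⟨⟨l, r⟩, hl⟩ := hne
  obtain ⟨f, s, hfC, hfx⟩ := geometric_hahn_banach_closed_point hCconv hC hx
  -- Adding multiples of the separating functional keeps a minorant on `C` but is unbounded at `x`.
  have hbound {t : ℝ} (ht : 0 ≤ t) : l x - r + t * (f x - s) ≤ M := by
    have hmem : (l + t • f, r + t * s) ∈ conjugateEpigraph C φ := fun y hy ↦ by
      have hfy := mul_nonneg ht (sub_nonneg.2 (hfC y hy).le)
      simp only [add_apply, smul_apply, smul_eq_mul]
      linarith [hl y hy]
    have hle := h _ hmem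
    simp only [add_apply, smul_apply, smul_eq_mul] at hle
    linarith
  have hgap : 0 < f x - s := sub_pos.2 hfx
  have hl_le : l x - r ≤ M := h _ hl
  have hM := hbound (t := (M - (l x - r) + 1) / (f x - s)) (div_nonneg (by linarith) hgap.le)
  rw [div_mul_cancel₀ _ hgap.ne'] at hM
  linarith

/-- The Fenchel–Moreau theorem: `φ` extended by `+∞` off `C` equals its biconjugate. -/
theorem mem_and_le_iff_forall_mem_conjugateEpigraph (hC : IsClosed C) (hφ : ConvexOn ℝ C φ)
    (hφc : LowerSemicontinuousOn φ C) :
    x ∈ C ∧ φ x ≤ M ↔ ∀ p ∈ conjugateEpigraph C φ, p.1 x - p.2 ≤ M := by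
  refine ⟨fun ⟨hx, hM⟩ p hp ↦ (hp x hx).trans hM, fun h ↦ ?_⟩
  have hx : x ∈ C :=
    mem_of_forall_mem_conjugateEpigraph hφ.1 hC (conjugateEpigraph_nonempty hC hφ hφc) h
  refine ⟨hx, le_of_forall_lt_imp_le_of_dense fun a ha ↦ ?_⟩
  obtain ⟨p, hp, rfl⟩ := exists_mem_conjugateEpigraph_apply_sub_eq hC hφ hφc hx ha
  exact h p hp

end FenchelConjugate

section HalfNormSq

variable {E G : Type*} [SeminormedAddCommGroup E] [NormedSpace ℝ E] [SeminormedAddCommGroup G]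
  [NormedSpace ℝ G]

theorem half_norm_sq_add_half_norm_sq_add_apply_nonneg (l : StrongDual ℝ E) (v : E) :
    0 ≤ ‖v‖ ^ 2 / 2 + ‖l‖ ^ 2 / 2 + l v := by
  linarith [neg_le_of_abs_le (l.le_opNorm v), two_mul_le_add_sq ‖l‖ ‖v‖]

theorem half_norm_sq_le_of_forall_apply_sub_half_norm_sq_le (l : StrongDual ℝ E) {M : ℝ}
    (h : ∀ v, l v - ‖v‖ ^ 2 / 2 ≤ M) : ‖l‖ ^ 2 / 2 ≤ M := by
  have hM : 0 ≤ 2 * M := by simpa using h 0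
  have hnorm : ‖l‖ ≤ √(2 * M) := by
    refine l.opNorm_le_bound (Real.sqrt_nonneg _) fun v ↦ ?_
    refine abs_le_of_sq_le_sq ?_ (by positivity)
    have hquad (t : ℝ) : 0 ≤ ‖v‖ ^ 2 / 2 * (t * t) + -l v * t + M := by
      have htv := h (t • v)
      rw [map_smul, norm_smul, mul_pow, Real.norm_eq_abs, sq_abs, smul_eq_mul] at htv
      linarith
    have hdiscrim := discrim_le_zero hquad
    rw [discrim] at hdiscrim
    rw [mul_pow, Real.sq_sqrt hM]
    linarith
  linarith [(Real.le_sqrt (norm_nonneg l) hM).1 hnorm]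

theorem convexOn_half_norm_sq : ConvexOn ℝ Set.univ fun v : E ↦ ‖v‖ ^ 2 / 2 := by
  have hsq := (convexOn_univ_norm (E := E)).pow (fun _ _ ↦ norm_nonneg _) 2
  simpa [div_eq_inv_mul] using hsq.smul (c := (2⁻¹ : ℝ)) (by norm_num)

theorem exists_dual_pair_half_norm_sq_add_half_norm_sq_le {S : Set ((E × G) × ℝ)}
    (hS : Convex ℝ S) (hSne : S.Nonempty)
    (h : ∀ p ∈ S, 0 ≤ ‖p.1.1‖ ^ 2 / 2 + ‖p.1.2‖ ^ 2 / 2 + p.2) :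
    ∃ (a : StrongDual ℝ E) (b : StrongDual ℝ G), ∀ p ∈ S,
      ‖a‖ ^ 2 / 2 + ‖b‖ ^ 2 / 2 ≤ p.2 - a p.1.1 - b p.1.2 := by
  have hconcave : ConcaveOn ℝ Set.univ fun q : E × G ↦ -(‖q.1‖ ^ 2 / 2 + ‖q.2‖ ^ 2 / 2) :=
    ((convexOn_half_norm_sq.comp_linearMap (LinearMap.fst ℝ E G)).add
      (convexOn_half_norm_sq.comp_linearMap (LinearMap.snd ℝ E G))).neg
  obtain ⟨L, hL⟩ := exists_dual_sub_le_sub_of_concaveOn hS hSne hconcave (by fun_prop)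
    fun p hp ↦ neg_le_iff_add_nonneg'.2 (h p hp)
  let a : StrongDual ℝ E := L.comp (ContinuousLinearMap.inl ℝ E G)
  let b : StrongDual ℝ G := L.comp (ContinuousLinearMap.inr ℝ E G)
  have hLab (q : E × G) : L q = a q.1 + b q.2 := (L.comp_inl_add_comp_inr q).symm
  refine ⟨a, b, fun p hp ↦ ?_⟩
  have hsup (v : E) (w : G) :
      (a v - ‖v‖ ^ 2 / 2) + (b w - ‖w‖ ^ 2 / 2) ≤ p.2 - a p.1.1 - b p.1.2 := by
    have hvw := hL p hp (-v, -w)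
    simp only [hLab, norm_neg, map_neg] at hvw
    linarith
  refine le_sub_iff_add_le'.1 (half_norm_sq_le_of_forall_apply_sub_half_norm_sq_le b fun w ↦ ?_)
  refine le_sub_comm.1 (half_norm_sq_le_of_forall_apply_sub_half_norm_sq_le a fun v ↦ ?_)
  exact le_sub_iff_add_le.2 (hsup v w)

end HalfNormSq

section Monotone

variable {X : Type*} [NormedAddCommGroup X] [NormedSpace ℝ X]

section Reflexive

variable {S : Set ((X × StrongDual ℝ X) × ℝ)}

theorem IsReflexiveSpace.exists_half_norm_sq_add_half_norm_sq_le (hX : IsReflexiveSpace X)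
    (hS : Convex ℝ S) (hSne : S.Nonempty)
    (h : ∀ p ∈ S, 0 ≤ ‖p.1.1‖ ^ 2 / 2 + ‖p.1.2‖ ^ 2 / 2 + p.2) :
    ∃ (x : X) (x' : StrongDual ℝ X), ∀ p ∈ S,
      ‖x‖ ^ 2 / 2 + ‖x'‖ ^ 2 / 2 ≤ p.2 - x' p.1.1 - p.1.2 x := by
  obtain ⟨x', x'', hxx⟩ := exists_dual_pair_half_norm_sq_add_half_norm_sq_le hS hSne h
  obtain ⟨x, rfl⟩ := hX x''
  have hnorm : ‖NormedSpace.inclusionInDoubleDual ℝ X x‖ = ‖x‖ :=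
    (NormedSpace.inclusionInDoubleDualLi (E := X) ℝ).norm_map x
  refine ⟨x, x', fun p hp ↦ ?_⟩
  simpa only [hnorm, NormedSpace.dual_def, add_comm] using hxx p hp

theorem IsReflexiveSpace.exists_half_norm_sub_sq_add_half_norm_sub_sq_le
    (hX : IsReflexiveSpace X) (hS : Convex ℝ S) (hSne : S.Nonempty)
    (h : ∀ p ∈ S, p.1.2 p.1.1 ≤ p.2) (x₀ : X) (x₀' : StrongDual ℝ X) :
    ∃ (x : X) (x' : StrongDual ℝ X), ∀ p ∈ S,
      ‖x - x₀‖ ^ 2 / 2 + ‖x' - x₀'‖ ^ 2 / 2 + (x' - x₀') (x - x₀) ≤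
        p.2 - x' p.1.1 - p.1.2 x + x' x := by
  let shift : (X × StrongDual ℝ X) × ℝ → (X × StrongDual ℝ X) × ℝ := fun p ↦
    ((p.1.1 - x₀, p.1.2 - x₀'), p.2 - x₀' p.1.1 - p.1.2 x₀ + x₀' x₀)
  have hshift_convex : Convex ℝ (shift '' S) := by
    rintro _ ⟨p, hp, rfl⟩ _ ⟨q, hq, rfl⟩ a b ha hb hab
    refine ⟨a • p + b • q, hS hp hq ha hb hab, ?_⟩
    obtain rfl := eq_sub_of_add_eq' hab
    refine Prod.ext (Prod.ext ?_ ?_) ?_ <;>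
      simp only [shift, Prod.fst_add, Prod.snd_add, Prod.smul_fst, Prod.smul_snd, map_add, map_smul,
        add_apply, smul_apply, smul_eq_mul]
    · module
    · module
    · ring
  have hshift_nonneg : ∀ p ∈ shift '' S, 0 ≤ ‖p.1.1‖ ^ 2 / 2 + ‖p.1.2‖ ^ 2 / 2 + p.2 := by
    refine Set.forall_mem_image.2 fun p hp ↦ ?_
    have hyoung := half_norm_sq_add_half_norm_sq_add_apply_nonneg (p.1.2 - x₀') (p.1.1 - x₀)
    simp only [shift, sub_apply, map_sub] at hyoung ⊢
    linarith [h p hp]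
  obtain ⟨z, z', hz⟩ :=
    hX.exists_half_norm_sq_add_half_norm_sq_le hshift_convex (hSne.image shift) hshift_nonneg
  refine ⟨x₀ + z, x₀' + z', fun p hp ↦ ?_⟩
  have hzp := hz _ (Set.mem_image_of_mem shift hp)
  simp only [shift, add_sub_cancel_left, add_apply, sub_apply, map_add, map_sub] at hzp ⊢
  linarith

end Reflexive

section Bifunction

variable {C : Set X} {F : X → X → ℝ}

/-- The epigraph of the Fitzpatrick transform `(u, u') ↦ sup_{y ∈ C} (u' y + F y u)` of `F`, which
is `+∞` for `u ∉ C`. -/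
def fitzpatrickEpigraph (C : Set X) (F : X → X → ℝ) : Set ((X × StrongDual ℝ X) × ℝ) :=
  {p | p.1.1 ∈ C ∧ ∀ y ∈ C, p.1.2 y + F y p.1.1 ≤ p.2}

theorem convex_fitzpatrickEpigraph (hF : ∀ x ∈ C, ConvexOn ℝ C (F x)) :
    Convex ℝ (fitzpatrickEpigraph C F) := by
  rintro ⟨⟨u, u'⟩, r⟩ ⟨hu, hur⟩ ⟨⟨v, v'⟩, s⟩ ⟨hv, hvs⟩ a b ha hb hab
  refine ⟨(hF u hu).1 hu hv ha hb hab, fun y hy ↦ ?_⟩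
  have hFy := (hF y hy).2 hu hv ha hb hab
  have hau := mul_le_mul_of_nonneg_left (hur y hy) ha
  have hbv := mul_le_mul_of_nonneg_left (hvs y hy) hb
  simp only [Prod.smul_mk, Prod.mk_add_mk, add_apply, smul_apply, smul_eq_mul] at hFy hau hbv ⊢
  linarith

theorem apply_le_of_mem_fitzpatrickEpigraph (hF0 : ∀ x ∈ C, 0 ≤ F x x)
    {p : (X × StrongDual ℝ X) × ℝ} (hp : p ∈ fitzpatrickEpigraph C F) : p.1.2 p.1.1 ≤ p.2 := by
  linarith [hp.2 p.1.1 hp.1, hF0 p.1.1 hp.1]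

namespace IsMonotoneBifunction

theorem mem_fitzpatrickEpigraph (hF : IsMonotoneBifunction C F) {u : X} (hu : u ∈ C)
    {p : StrongDual ℝ X × ℝ} (hp : p ∈ conjugateEpigraph C (F u)) :
    ((u, p.1), p.2) ∈ fitzpatrickEpigraph C F :=
  ⟨hu, fun y hy ↦ by linarith [hp y hy, hF u hu y hy]⟩

theorem isMonotoneOperator (hF : IsMonotoneBifunction C F) (hF0 : ∀ x ∈ C, 0 ≤ F x x) :
    IsMonotoneOperator (bifunctionOperator C F) := by
  rintro x y x' ⟨hx, hx'⟩ y' ⟨hy, hy'⟩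
  have hxy := hx' y hy
  have hyx := hy' x hx
  rw [← neg_sub y x, map_neg] at hyx
  rw [sub_apply]
  linarith [hF x hx y hy, hF0 x hx, hF0 y hy]

end IsMonotoneBifunction

theorem IsBOMaximalMonotoneBifunction.exists_mem_bifunctionOperator (hX : IsReflexiveSpace X)
    (hCne : C.Nonempty) (hC : IsClosed C) (hF0 : ∀ x ∈ C, 0 ≤ F x x)
    (hF : IsBOMaximalMonotoneBifunction C F) (hFconv : ∀ x ∈ C, ConvexOn ℝ C (F x))
    (hFlsc : ∀ x ∈ C, LowerSemicontinuousOn (F x) C) (x₀ : X) (x₀' : StrongDual ℝ X) :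
    ∃ x, ∃ x' ∈ bifunctionOperator C F x,
      ‖x - x₀‖ ^ 2 / 2 + ‖x' - x₀'‖ ^ 2 / 2 + (x' - x₀') (x - x₀) ≤ 0 := by
  obtain ⟨hmono, hBO⟩ := hF
  obtain ⟨u₀, hu₀⟩ := hCne
  have hne : (fitzpatrickEpigraph C F).Nonempty :=
    (conjugateEpigraph_nonempty hC (hFconv u₀ hu₀) (hFlsc u₀ hu₀)).elim fun _ hp ↦
      ⟨_, hmono.mem_fitzpatrickEpigraph hu₀ hp⟩
  obtain ⟨x, x', hgap⟩ := hX.exists_half_norm_sub_sq_add_half_norm_sub_sq_le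
    (convex_fitzpatrickEpigraph hFconv) hne
    (fun _ ↦ apply_le_of_mem_fitzpatrickEpigraph hF0) x₀ x₀'
  set D := ‖x - x₀‖ ^ 2 / 2 + ‖x' - x₀'‖ ^ 2 / 2 + (x' - x₀') (x - x₀)
  have hD : 0 ≤ D := half_norm_sq_add_half_norm_sq_add_apply_nonneg _ _
  have hFx (u) (hu : u ∈ C) : x ∈ C ∧ F u x ≤ x' x - x' u - D :=
    (mem_and_le_iff_forall_mem_conjugateEpigraph hC (hFconv u hu) (hFlsc u hu)).2 fun p hp ↦ by
      linarith [hgap _ (hmono.mem_fitzpatrickEpigraph hu hp)]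
  have hx : x ∈ C := (hFx u₀ hu₀).1
  have hBOx : ∀ y ∈ C, x' (y - x) ≤ F x y := hBO x hx x' fun u hu ↦ by
    rw [map_sub]
    linarith [(hFx u hu).2]
  refine ⟨x, x', ⟨hx, fun y hy ↦ ?_⟩, ?_⟩
  · linarith [hBOx y hy, hmono x hx x hx]
  · change D ≤ 0
    linarith [(hFx x hx).2, hF0 x hx]

end Bifunction

/-- A form of Minty's criterion: the inequality says that `x₀' - x'` is a duality vector of
`x - x₀`. -/
theorem IsMonotoneOperator.isMaximalMonotoneOperator {T : X → Set (StrongDual ℝ X)}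
    (hT : IsMonotoneOperator T)
    (h : ∀ x₀ x₀', ∃ x, ∃ x' ∈ T x,
      ‖x - x₀‖ ^ 2 / 2 + ‖x' - x₀'‖ ^ 2 / 2 + (x' - x₀') (x - x₀) ≤ 0) :
    IsMaximalMonotoneOperator T := by
  refine ⟨hT, fun S hS hTS ↦ hTS.2 fun ⟨x₀, x₀'⟩ hx₀ ↦ ?_⟩
  obtain ⟨x, x', hx', hle⟩ := h x₀ x₀'
  have hxS : (x, x') ∈ operatorGraph S := hTS.subset hx'
  have hnonneg : 0 ≤ (x' - x₀') (x - x₀) := hS x₀ x x₀' hx₀ x' hxS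
  have hx : x - x₀ = 0 := norm_eq_zero.1 <| by
    nlinarith [sq_nonneg ‖x - x₀‖, sq_nonneg ‖x' - x₀'‖]
  have hx'_eq : x' - x₀' = 0 := norm_eq_zero.1 <| by
    nlinarith [sq_nonneg ‖x - x₀‖, sq_nonneg ‖x' - x₀'‖]
  rwa [sub_eq_zero.1 hx, sub_eq_zero.1 hx'_eq] at hx'

end Monotone

theorem mainTheorem11 {X : Type*} [NormedAddCommGroup X] [NormedSpace ℝ X] [CompleteSpace X]
    (hX : IsReflexiveSpace X) (C : Set X) (hCne : C.Nonempty) (hCcl : IsClosed C)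
    (hCconv : Convex ℝ C) (F : X → X → ℝ) (hF0 : ∀ x ∈ C, F x x = 0)
    (hFBO : IsBOMaximalMonotoneBifunction C F)
    (hFconv : ∀ x ∈ C, ConvexOn ℝ C (F x))
    (hFlsc : ∀ x ∈ C, LowerSemicontinuousOn (F x) C) :
    IsMaximalMonotoneBifunction C F := by
  have hF0' : ∀ x ∈ C, 0 ≤ F x x := fun x hx ↦ (hF0 x hx).ge
  exact ⟨hFBO.1, (hFBO.1.isMonotoneOperator hF0').isMaximalMonotoneOperator
    (hFBO.exists_mem_bifunctionOperator hX hCne hCcl hF0' hFconv hFlsc)⟩
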